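/- Let $\mathbb T=\mathbb R/\mathbb Z$, let $A=C(\mathbb T^2)$ be the algebra of continuous complex-valued functions on $\mathbb T^2=(\mathbb R/\mathbb Z)^2$, and equip $\mathbb T^2$ with the flat metric $$d((r,s),(t,u))=\min\{((r-t-m)^2+(s-u-n)^2)^{1/2}: m,n\in\mathbb Z\}.$$ For $k\in\mathbb Z$ let $$\Xi_k=\{\xi\in C(\mathbb T\times\mathbb R,\mathbb C):\ \xi(r,s+1)=e^{2\pi i k r}\,\xi(r,s)\ \text{ for all } r\in\mathbb T,\ s\in\mathbb R\},$$ an $A$-module under pointwise multiplication (functions on $\mathbb T^2$ being viewed as functions on $\mathbb T\times\mathbb R$ of period $1$ in $s$). For a matrix $a\in M_n(A)$, viewed as a continuous function $\mathbb T^2\to M_n(\mathbb C)$, let $$L(a)=\sup\{\|a(x)-a(y)\|/d(x,y): x,y\in\mathbb T^2,\ x\ne y\}\in[0,\infty],$$ where $\|\cdot\|$ is the operator norm on $M_n(\mathbb C)$ for the standard inner product on $\mathbb C^n$. A projection $p\in M_n(A)$ (that is, $p^2=p=p^*$) is said to represent $\Xi_k$ if $\Xi_k\cong pA^n$ as $A$-modules.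 Proposition. For every $k\in\mathbb Z$, every $n\in\mathbb N$ and every projection $p\in M_n(A)$ representing $\Xi_k$, $$L(p)\ \ge\ (\pi|k|)^{1/2}.$$ -/

import Mathlib

open scoped ENNReal

noncomputable section

/-- The Lipschitz seminorm `L(a) = sup {‖a(x) - a(y)‖ / ρ(x, y) : x ≠ y}`, possibly `∞`, of a matrix
`a ∈ M_n(C(X))` viewed as a continuous matrix-valued function on the metric space `X`. The norm on
`M_n(ℂ)` is the operator norm on the Hilbert space `ℂⁿ`. -/
def lipSeminorm {X : Type*} [MetricSpace X] {n : ℕ} (a : Matrix (Fin n) (Fin n) C(X, ℂ)) : ℝ≥0∞ :=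
  ⨆ (x : X) (y : X) (_ : x ≠ y),
    ENNReal.ofReal
      (‖Matrix.toEuclideanCLM (n := Fin n) (𝕜 := ℂ)
          (a.map (fun f => f x) - a.map (fun f => f y))‖ / dist x y)

/-- A projection `p ∈ M_n(A)` represents the `A`-module `Ξ` if `p² = p = p*` and `Ξ ≅ p Aⁿ` as
`A`-modules. -/
def RepresentedBy {A : Type*} [CommRing A] [StarRing A] (Ξ : Type*) [AddCommGroup Ξ] [Module A Ξ]
    {n : ℕ} (p : Matrix (Fin n) (Fin n) A) : Prop :=
  IsStarProjection p ∧ Nonempty (Ξ ≃ₗ[A] LinearMap.range (Matrix.mulVecLin p))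

/-- The flat torus `(ℝ/ℤ)²`: the `ℓ²`-product of two copies of the circle `ℝ/ℤ`, whose distance is
`min {|r - t - m| : m ∈ ℤ}`. -/
abbrev FlatTorus : Type := WithLp 2 (UnitAddCircle × UnitAddCircle)

/-- The covering map `𝕋 × ℝ → 𝕋²`, `(r, s) ↦ (r, s + ℤ)`. -/
def torusCover : C(UnitAddCircle × ℝ, FlatTorus) where
  toFun z := WithLp.toLp 2 (z.1, (z.2 : UnitAddCircle))
  continuous_toFun := by
    refine (WithLp.prod_continuous_toLp 2 _ _).comp ?_
    exact continuous_fst.prodMk ((AddCircle.continuous_mk' 1).comp continuous_snd)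

/-- `C(𝕋²)` acts on `C(𝕋 × ℝ)` by pointwise multiplication, functions on `𝕋²` being viewed as
functions on `𝕋 × ℝ` of period `1` in the second variable. -/
instance torusModule : Module C(FlatTorus, ℂ) C(UnitAddCircle × ℝ, ℂ) :=
  Module.compHom C(UnitAddCircle × ℝ, ℂ)
    (ContinuousMap.compRightAlgHom ℂ ℂ torusCover).toRingHom

theorem torusModule_smul_apply (a : C(FlatTorus, ℂ)) (ξ : C(UnitAddCircle × ℝ, ℂ))
    (r : UnitAddCircle) (s : ℝ) :
    (a • ξ) (r, s) = a (WithLp.toLp 2 (r, (s : UnitAddCircle))) * ξ (r, s) := rfl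

/-- The module of continuous sections of the `k`-th line bundle on the torus: the continuous
`ξ : 𝕋 × ℝ → ℂ` with `ξ(r, s + 1) = e(kr) ξ(r, s)`, where `e(t) = exp(2πit)`. -/
def lineBundle (k : ℤ) : Submodule C(FlatTorus, ℂ) C(UnitAddCircle × ℝ, ℂ) where
  carrier := {ξ | ∀ (r : UnitAddCircle) (s : ℝ), ξ (r, s + 1) = fourier k r * ξ (r, s)}
  zero_mem' := by intro r s; simp
  add_mem' := by
    intro ξ η hξ hη r s
    rw [ContinuousMap.add_apply, ContinuousMap.add_apply, hξ r s, hη r s]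
    ring
  smul_mem' := by
    intro a ξ hξ r s
    have h : ((s + 1 : ℝ) : UnitAddCircle) = (s : UnitAddCircle) := AddCircle.coe_add_period 1 s
    rw [torusModule_smul_apply, torusModule_smul_apply, hξ r s, h]
    ring

end

open scoped InnerProductSpace ComplexConjugate
open Filter Topology

/-! ### Second-order estimates for products of four nearby projections. -/

section FourProjections

variable {E : Type*} [NormedAddCommGroup E] [InnerProductSpace ℂ E] [CompleteSpace E]

/-! The number `k` is the Chern number of the line bundle, and it is computed on a lattice. Over 𝕋 ×
ℝ the projection is the orthogonal projection onto the line of a continuous unit vector `v`,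
periodic in `r` and twisted by e(-kr) when `s` grows by 1 (`exists_factorization`). On an N × N grid
the phases of the inner products of neighbouring vectors telescope, so the phases around the unit
cells add up to exactly 2πk (`sum_arg_plaquette`).

The product around a cell does not depend on the phases of the vectors: it is ⟪v, p₁ p₂ p₃ v⟫ for
the projections at the corners. Its imaginary part is, up to O(N⁻³), at most the product of the
variations of the projection along the two diagonals, that is (√2 L/N)² = 2L²/N²
(`abs_im_inner_four_projections_le`), and its real part tends to 1. Summing over N² cells gives
2π|k| ≤ 2L² + O(1/N). Using the diagonals rather than the sides is what yields the constant π. -/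

theorem IsStarProjection.inner_left_eq {p : E →L[ℂ] E} (hp : IsStarProjection p) (x y : E) :
    ⟪p x, y⟫_ℂ = ⟪x, p y⟫_ℂ :=
  hp.isSelfAdjoint.isSymmetric x y

theorem IsStarProjection.apply_apply {p : E →L[ℂ] E} (hp : IsStarProjection p) (x : E) :
    p (p x) = p x := by
  have h := hp.isIdempotentElem
  exact congrArg (fun q : E →L[ℂ] E => q x) h

theorem IsStarProjection.norm_apply_le {p : E →L[ℂ] E} (hp : IsStarProjection p) (x : E) :
    ‖p x‖ ≤ ‖x‖ := by
  simpa using p.le_of_opNorm_le hp.norm_le x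

/-- Compressing `q - p` by the projection `p` gives an expression of second order in `q - p`. -/
theorem IsStarProjection.apply_sub_apply_self {p q : E →L[ℂ] E} (hp : IsStarProjection p)
    (hq : IsStarProjection q) (x : E) :
    p ((q - p) (p x)) = -p ((q - p) ((q - p) (p x))) := by
  simp only [sub_apply, map_sub, hp.apply_apply, hq.apply_apply]
  abel

/-- The imaginary part of the four-point Bargmann invariant of projections is controlled to second
order by the product of the two diagonals. -/
theorem abs_im_inner_four_projections_le {p₀ p₁ p₂ p₃ : E →L[ℂ] E}
    (h₁ : IsStarProjection p₁) (h₂ : IsStarProjection p₂) (h₃ : IsStarProjection p₃) {l : ℝ}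
    (d₁₂ : ‖p₁ - p₂‖ ≤ l) (d₀₂ : ‖p₀ - p₂‖ ≤ √2 * l) (d₁₃ : ‖p₃ - p₁‖ ≤ √2 * l)
    {v : E} (hv : ‖v‖ = 1) (hpv : p₀ v = v) :
    |(⟪v, p₁ (p₂ (p₃ v))⟫_ℂ).im| ≤ 2 * l ^ 2 + 4 * l ^ 3 := by
  have hl : 0 ≤ l := (norm_nonneg _).trans d₁₂
  -- The three extra terms of the expanded inner product are real, so they can be inserted freely;
  -- both factors are then of first order.
  have key : (⟪v, p₁ (p₂ (p₃ v))⟫_ℂ).im = (⟪p₂ (p₁ v) - v, (p₃ - p₁) v⟫_ℂ).im := by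
    have e₁ : (⟪p₂ (p₁ v), p₁ v⟫_ℂ).im = 0 := by
      rw [← h₂.apply_apply, h₂.inner_left_eq]
      exact inner_self_im (𝕜 := ℂ) _
    have e₃ : (⟪v, p₃ v⟫_ℂ).im = 0 := by
      rw [← h₃.apply_apply, ← h₃.inner_left_eq]
      exact inner_self_im (𝕜 := ℂ) _
    have e₁' : (⟪v, p₁ v⟫_ℂ).im = 0 := by
      rw [← h₁.apply_apply, ← h₁.inner_left_eq]
      exact inner_self_im (𝕜 := ℂ) _
    rw [← h₁.inner_left_eq, ← h₂.inner_left_eq, inner_sub_left, sub_apply,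
      inner_sub_right, inner_sub_right]
    simp only [Complex.sub_im, e₁, e₃, e₁']
    ring
  have op : ∀ {T : E →L[ℂ] E} {c : ℝ} (x : E), ‖T‖ ≤ c → ‖T x‖ ≤ c * ‖x‖ :=
    fun {T c} x h => T.le_of_opNorm_le h x
  have hpv₂ : ‖p₂ v‖ ≤ 1 := (h₂.norm_apply_le v).trans hv.le
  have b₁ : ‖p₂ ((p₁ - p₂) (p₂ v))‖ ≤ l ^ 2 := by
    rw [h₂.apply_sub_apply_self h₁, norm_neg]
    calc _ ≤ ‖(p₁ - p₂) ((p₁ - p₂) (p₂ v))‖ := h₂.norm_apply_le _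
      _ ≤ l * (l * 1) := (op _ d₁₂).trans (by gcongr; exact (op _ d₁₂).trans (by gcongr))
      _ = l ^ 2 := by ring
  have b₂ : ‖p₂ ((p₁ - p₂) ((p₀ - p₂) v))‖ ≤ √2 * l ^ 2 := by
    calc _ ≤ ‖(p₁ - p₂) ((p₀ - p₂) v)‖ := h₂.norm_apply_le _
      _ ≤ l * (√2 * l * 1) := (op _ d₁₂).trans (by gcongr; exact (op _ d₀₂).trans (by rw [hv]))
      _ = √2 * l ^ 2 := by ring
  have b₃ : ‖(p₀ - p₂) v‖ ≤ √2 * l := (op v d₀₂).trans (by rw [hv, mul_one])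
  have b₄ : ‖(p₃ - p₁) v‖ ≤ √2 * l := (op v d₁₃).trans (by rw [hv, mul_one])
  -- Only the diagonal difference `(p₀ - p₂) v` is of first order; the other two terms are O(l²).
  have split : p₂ (p₁ v) - v =
      p₂ ((p₁ - p₂) (p₂ v)) + p₂ ((p₁ - p₂) ((p₀ - p₂) v)) - (p₀ - p₂) v := by
    simp only [sub_apply, map_sub, h₂.apply_apply, hpv]
    abel
  have b₅ : ‖p₂ (p₁ v) - v‖ ≤ l ^ 2 + √2 * l ^ 2 + √2 * l := by
    rw [split]
    exact (norm_sub_le _ _).trans (add_le_add ((norm_add_le _ _).trans (add_le_add b₁ b₂)) b₃)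
  rw [key]
  have hs : √2 ^ 2 = (2 : ℝ) := Real.sq_sqrt (by norm_num)
  have hs' : √2 ≤ (2 : ℝ) := by nlinarith [Real.sqrt_nonneg 2]
  calc _ ≤ ‖⟪p₂ (p₁ v) - v, (p₃ - p₁) v⟫_ℂ‖ := Complex.abs_im_le_norm _
    _ ≤ ‖p₂ (p₁ v) - v‖ * ‖(p₃ - p₁) v‖ := norm_inner_le_norm _ _
    _ ≤ (l ^ 2 + √2 * l ^ 2 + √2 * l) * (√2 * l) := by gcongr
    _ = √2 ^ 2 * l ^ 2 + (√2 + √2 ^ 2) * l ^ 3 := by ring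
    _ ≤ 2 * l ^ 2 + 4 * l ^ 3 := by rw [hs]; gcongr; linarith

/-- Serves as the denominator when the argument is bounded by |im| / re. A crude first-order bound
suffices, since it disappears in the limit. -/
theorem one_sub_le_re_inner_four_projections {p₀ p₁ p₂ p₃ : E →L[ℂ] E}
    (h₁ : IsStarProjection p₁) (h₂ : IsStarProjection p₂) {l : ℝ}
    (d₀₁ : ‖p₁ - p₀‖ ≤ l) (d₀₂ : ‖p₂ - p₀‖ ≤ √2 * l) (d₀₃ : ‖p₃ - p₀‖ ≤ l)
    {v : E} (hv : ‖v‖ = 1) (hpv : p₀ v = v) :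
    1 - 4 * l ≤ (⟪v, p₁ (p₂ (p₃ v))⟫_ℂ).re := by
  have hl : 0 ≤ l := (norm_nonneg _).trans d₀₁
  have hs' : √2 ≤ (2 : ℝ) := by nlinarith [Real.sqrt_nonneg 2, Real.sq_sqrt (x := 2) (by norm_num)]
  have op : ∀ {T : E →L[ℂ] E} {c : ℝ}, ‖T - p₀‖ ≤ c → ‖T v - v‖ ≤ c := fun {T c} h => by
    simpa [hv, hpv] using (T - p₀).le_of_opNorm_le h v
  have split : p₁ (p₂ (p₃ v)) - v = p₁ (p₂ (p₃ v - v)) + p₁ (p₂ v - v) + (p₁ v - v) := by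
    simp only [map_sub]; abel
  have b : ‖p₁ (p₂ (p₃ v)) - v‖ ≤ 4 * l := by
    rw [split]
    calc _ ≤ ‖p₁ (p₂ (p₃ v - v))‖ + ‖p₁ (p₂ v - v)‖ + ‖p₁ v - v‖ := norm_add₃_le
      _ ≤ l + √2 * l + l := by
        gcongr
        · exact (h₁.norm_apply_le _).trans ((h₂.norm_apply_le _).trans (op d₀₃))
        · exact (h₁.norm_apply_le _).trans (op d₀₂)
        · exact op d₀₁
      _ ≤ 4 * l := by nlinarith
  have e : ⟪v, p₁ (p₂ (p₃ v))⟫_ℂ = 1 + ⟪v, p₁ (p₂ (p₃ v)) - v⟫_ℂ := by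
    rw [inner_sub_right, inner_self_eq_norm_sq_to_K, hv]; simp
  have b' : |(⟪v, p₁ (p₂ (p₃ v)) - v⟫_ℂ).re| ≤ 4 * l :=
    (Complex.abs_re_le_norm _).trans ((norm_inner_le_norm _ _).trans (by rw [hv, one_mul]; exact b))
  rw [e, Complex.add_re, Complex.one_re]
  linarith [(abs_le.1 b').1]

end FourProjections

/-! ### Principal arguments without branch jumps. -/

section Arg

open Complex

theorem Complex.abs_arg_le_abs_im_div_re {z : ℂ} (hz : 0 < z.re) : |arg z| ≤ |z.im| / z.re := by
  have h : |arg z| < Real.pi / 2 := abs_arg_lt_pi_div_two_iff.2 (Or.inl hz)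
  have ht := Real.le_tan (abs_nonneg _) h
  have habs : Real.tan |arg z| = |Real.tan (arg z)| := by
    rcases le_total 0 (arg z) with h0 | h0
    · rw [abs_of_nonneg h0, abs_of_nonneg]
      exact Real.tan_nonneg_of_nonneg_of_le_pi_div_two h0 ((le_abs_self _).trans h.le)
    · rw [abs_of_nonpos h0, Real.tan_neg, abs_of_nonpos]
      exact Real.tan_nonpos_of_nonpos_of_neg_pi_div_two_le h0 (by linarith [neg_abs_le (arg z)])
  rwa [habs, tan_arg, abs_div, abs_of_pos hz] at ht

theorem Complex.abs_arg_lt_pi_div_four_of_norm_sub_one {z : ℂ} (hz : ‖z - 1‖ ≤ 1 / 4) :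
    z ≠ 0 ∧ |arg z| < Real.pi / 4 := by
  have h1 := (abs_le.1 ((abs_re_le_norm _).trans hz)).1
  have h2 := (abs_im_le_norm _).trans hz
  simp only [sub_re, one_re, sub_im, one_im, sub_zero] at h1 h2
  have hre : 3 / 4 ≤ z.re := by linarith
  refine ⟨fun h => by norm_num [h] at hre, (abs_arg_le_abs_im_div_re (by linarith)).trans_lt ?_⟩
  rw [div_lt_iff₀ (by linarith)]
  nlinarith [Real.pi_gt_three]

/-- Four angles below π/4 in absolute value have all partial sums inside (-π, π), so the principal
branch is never left. -/
theorem Complex.arg_mul_mul_conj_mul_conj {a b c d : ℂ} (ha : a ≠ 0 ∧ |arg a| < Real.pi / 4)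
    (hb : b ≠ 0 ∧ |arg b| < Real.pi / 4) (hc : c ≠ 0 ∧ |arg c| < Real.pi / 4)
    (hd : d ≠ 0 ∧ |arg d| < Real.pi / 4) :
    arg (a * b * conj c * conj d) = arg a + arg b - arg c - arg d := by
  have conj_arg : ∀ {z : ℂ}, |arg z| < Real.pi / 4 → arg (conj z) = -arg z := fun {z} h => by
    rw [arg_conj, if_neg]
    intro h'
    rw [h', abs_of_pos Real.pi_pos] at h
    linarith [Real.pi_pos]
  obtain ⟨ha0, ha⟩ := ha
  obtain ⟨hb0, hb⟩ := hb
  obtain ⟨hc0, hc⟩ := hc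
  obtain ⟨hd0, hd⟩ := hd
  have hc' := conj_arg hc
  have hd' := conj_arg hd
  rw [abs_lt] at ha hb hc hd
  have e1 : arg (a * b) = arg a + arg b :=
    (arg_mul_eq_add_arg_iff ha0 hb0).2 ⟨by linarith [Real.pi_pos], by linarith [Real.pi_pos]⟩
  have e2 : arg (a * b * conj c) = arg a + arg b - arg c := by
    rw [(arg_mul_eq_add_arg_iff (mul_ne_zero ha0 hb0) (by simpa using hc0)).2, e1, hc',
      sub_eq_add_neg]
    rw [e1, hc']
    exact ⟨by linarith [Real.pi_pos], by linarith [Real.pi_pos]⟩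
  rw [(arg_mul_eq_add_arg_iff (mul_ne_zero (mul_ne_zero ha0 hb0) (by simpa using hc0))
    (by simpa using hd0)).2, e2, hd', ← sub_eq_add_neg]
  rw [e2, hd']
  exact ⟨by linarith [Real.pi_pos], by linarith [Real.pi_pos]⟩

theorem Complex.arg_exp_mul_of_small {z : ℂ} (hz : z ≠ 0 ∧ |arg z| < Real.pi / 4) {t : ℝ}
    (ht : |t| < Real.pi / 4) : arg (exp (t * I) * z) = t + arg z := by
  have et : arg (exp (t * I)) = t := by
    rw [abs_lt] at ht
    exact arg_exp_mul_I t ▸ (toIocMod_eq_self _).2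
      ⟨by linarith [Real.pi_pos], by linarith [Real.pi_pos]⟩
  have h := abs_lt.1 ht
  have h' := abs_lt.1 hz.2
  rw [(arg_mul_eq_add_arg_iff (exp_ne_zero _) hz.1).2, et]
  rw [et]
  exact ⟨by linarith [Real.pi_pos], by linarith [Real.pi_pos]⟩

end Arg

/-! ### The lattice Chern number. -/

section Lattice

variable {E : Type*} [NormedAddCommGroup E] [InnerProductSpace ℂ E]

/-- The product of the four link variables around the plaquette with corner `(i, j)`. -/
noncomputable def plaquette (v : ℕ → ℕ → E) (i j : ℕ) : ℂ :=
  ⟪v i j, v (i + 1) j⟫_ℂ * ⟪v (i + 1) j, v (i + 1) (j + 1)⟫_ℂ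
    * conj ⟪v i (j + 1), v (i + 1) (j + 1)⟫_ℂ * conj ⟪v i j, v i (j + 1)⟫_ℂ

/-- The lattice Chern number of a twisted-periodic field of vectors. -/
theorem sum_arg_plaquette {N : ℕ} {v : ℕ → ℕ → E} {k : ℤ} (hN : N ≠ 0)
    (hk : |2 * Real.pi * k / N| < Real.pi / 4)
    (hx : ∀ i < N, ∀ j ≤ N, ‖⟪v i j, v (i + 1) j⟫_ℂ - 1‖ ≤ 1 / 4)
    (hy : ∀ i ≤ N, ∀ j < N, ‖⟪v i j, v i (j + 1)⟫_ℂ - 1‖ ≤ 1 / 4)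
    (px : ∀ j, v N j = v 0 j)
    (py : ∀ i, v i N = Complex.exp ((-(2 * Real.pi * k * i / N) : ℝ) * Complex.I) • v i 0) :
    ∑ i ∈ Finset.range N, ∑ j ∈ Finset.range N, (plaquette v i j).arg = 2 * Real.pi * k := by
  have harg : ∀ i ∈ Finset.range N, ∀ j ∈ Finset.range N, (plaquette v i j).arg =
      ((⟪v (i + 1) j, v (i + 1) (j + 1)⟫_ℂ).arg - (⟪v i j, v i (j + 1)⟫_ℂ).arg)
      - ((⟪v i (j + 1), v (i + 1) (j + 1)⟫_ℂ).arg - (⟪v i j, v (i + 1) j⟫_ℂ).arg) := by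
    intro i hi j hj
    rw [Finset.mem_range] at hi hj
    rw [plaquette, Complex.arg_mul_mul_conj_mul_conj
      (Complex.abs_arg_lt_pi_div_four_of_norm_sub_one (hx i hi j hj.le))
      (Complex.abs_arg_lt_pi_div_four_of_norm_sub_one (hy (i + 1) hi j hj))
      (Complex.abs_arg_lt_pi_div_four_of_norm_sub_one (hx i hi (j + 1) hj))
      (Complex.abs_arg_lt_pi_div_four_of_norm_sub_one (hy i hi.le j hj))]
    ring
  -- The twists at `i` and `i + 1` differ by the fixed angle -2πk/N, small enough to add to the
  -- argument without a jump.
  have htwist : ∀ i ∈ Finset.range N, (⟪v i N, v (i + 1) N⟫_ℂ).arg =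
      -(2 * Real.pi * k / N) + (⟪v i 0, v (i + 1) 0⟫_ℂ).arg := by
    intro i hi
    rw [Finset.mem_range] at hi
    rw [← Complex.arg_exp_mul_of_small
      (Complex.abs_arg_lt_pi_div_four_of_norm_sub_one (hx i hi 0 (Nat.zero_le _)))
      (by rwa [abs_neg]), py, py, inner_smul_left, inner_smul_right, ← Complex.exp_conj,
      ← mul_assoc, ← Complex.exp_add]
    congr 3
    simp only [map_mul, Complex.conj_ofReal, Complex.conj_I]
    push_cast
    ring
  rw [Finset.sum_congr rfl fun i hi => Finset.sum_congr rfl (harg i hi)]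
  simp only [Finset.sum_sub_distrib]
  have e1 : ∀ f : ℕ → ℕ → ℝ, f N = f 0 →
      ∑ i ∈ Finset.range N, ∑ j ∈ Finset.range N, (f (i + 1) j)
      = ∑ i ∈ Finset.range N, ∑ j ∈ Finset.range N, f i j := fun f hf => by
    have := Finset.sum_range_sub (fun i => ∑ j ∈ Finset.range N, f i j) N
    simp only [hf, sub_self, Finset.sum_sub_distrib] at this
    linarith
  -- Periodicity in the first index cancels all links in the second direction; only the twist
  -- between top and bottom rows survives.
  rw [e1 (fun i j => (⟪v i j, v i (j + 1)⟫_ℂ).arg) (by ext j; simp only [px]), sub_self, zero_sub,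
    ← Finset.sum_sub_distrib, ← Finset.sum_neg_distrib]
  have e2 : ∀ i ∈ Finset.range N,
      -(∑ j ∈ Finset.range N, (⟪v i (j + 1), v (i + 1) (j + 1)⟫_ℂ).arg
        - ∑ j ∈ Finset.range N, (⟪v i j, v (i + 1) j⟫_ℂ).arg) = 2 * Real.pi * k / N := by
    intro i hi
    rw [← Finset.sum_sub_distrib,
      Finset.sum_range_sub (fun j => (⟪v i j, v (i + 1) j⟫_ℂ).arg) N, htwist i hi]
    ring
  rw [Finset.sum_congr rfl e2, Finset.sum_const, Finset.card_range, nsmul_eq_mul]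
  field_simp

end Lattice

/-! ### From the lattice to the bound, by refining the grid. -/

section ChernBound

variable {E : Type*} [NormedAddCommGroup E] [InnerProductSpace ℂ E]

theorem norm_inner_sub_one_le {v w : E} (hv : ‖v‖ = 1) : ‖⟪v, w⟫_ℂ - 1‖ ≤ dist w v := by
  have h : ⟪v, w⟫_ℂ - 1 = ⟪v, w - v⟫_ℂ := by
    rw [inner_sub_right, inner_self_eq_norm_sq_to_K, hv]; simp
  rw [h, dist_eq_norm]
  exact (norm_inner_le_norm _ _).trans (by rw [hv, one_mul])

/-- A unit vector field on the square whose boundary values are twisted by `e(-kr)` and whose rank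
one projections are `L`-Lipschitz has `π|k| ≤ L²`. -/
theorem pi_mul_abs_le_sq_of_lipschitz [CompleteSpace E] {v : ℝ → ℝ → E} {P : ℝ → ℝ → E →L[ℂ] E}
    {k : ℤ} {L : ℝ}
    (hc : Continuous fun z : ℝ × ℝ => v z.1 z.2) (hv : ∀ r s, ‖v r s‖ = 1)
    (px : ∀ s, v 1 s = v 0 s)
    (py : ∀ r, v r 1 = Complex.exp ((-(2 * Real.pi * k * r) : ℝ) * Complex.I) • v r 0)
    (hP : ∀ r s, IsStarProjection (P r s))
    (hPv : ∀ r s y, P r s y = ⟪v r s, y⟫_ℂ • v r s) (hL : 0 ≤ L)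
    (hlip : ∀ r s r' s', ‖P r s - P r' s'‖ ≤ L * √((r - r') ^ 2 + (s - s') ^ 2)) :
    Real.pi * |(k : ℝ)| ≤ L ^ 2 := by
  have hPself : ∀ r s, P r s (v r s) = v r s := fun r s => by
    rw [hPv, inner_self_eq_norm_sq_to_K, hv]; simp
  -- The field `v` itself is only continuous. This controls the branches of the arguments; `L`
  -- enters through the projections alone.
  obtain ⟨δ, hδ, hδv⟩ := Metric.uniformContinuousOn_iff.1
    ((isCompact_Icc (a := ((0 : ℝ), (0 : ℝ))) (b := (1, 1))).uniformContinuousOn_of_continuous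
      hc.continuousOn) (1 / 4) (by norm_num)
  have hinv : Tendsto (fun N : ℕ => (N : ℝ)⁻¹) atTop (𝓝 0) := tendsto_inv_atTop_nhds_zero_nat
  have hmain : ∀ᶠ N : ℕ in atTop,
      2 * Real.pi * |(k : ℝ)| ≤ (2 * L ^ 2 + 4 * L ^ 3 * (N : ℝ)⁻¹) / (1 - 4 * (L * (N : ℝ)⁻¹)) := by
    have t1 : ∀ᶠ N : ℕ in atTop, (N : ℝ)⁻¹ < δ := hinv.eventually_lt_const hδ
    have t2 : ∀ᶠ N : ℕ in atTop, |2 * Real.pi * k * (N : ℝ)⁻¹| < Real.pi / 4 := by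
      have : Tendsto (fun N : ℕ => |2 * Real.pi * k * (N : ℝ)⁻¹|) atTop
          (𝓝 |2 * Real.pi * k * 0|) := (hinv.const_mul _).abs
      exact this.eventually_lt_const (by simp [Real.pi_pos])
    have t3 : ∀ᶠ N : ℕ in atTop, 4 * (L * (N : ℝ)⁻¹) < 1 :=
      ((hinv.const_mul L).const_mul 4).eventually_lt_const (by simp)
    filter_upwards [t1, t2, t3, eventually_gt_atTop 0] with N h1 h2 h3 hN
    have hN' : (0 : ℝ) < N := by exact_mod_cast hN
    set h : ℝ := (N : ℝ)⁻¹ with hh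
    have hpos : 0 < h := by positivity
    have hNh : (N : ℝ) * h = 1 := mul_inv_cancel₀ hN'.ne'
    set w : ℕ → ℕ → E := fun i j => v (i * h) (j * h) with hw
    have mem : ∀ i ≤ N, ∀ j ≤ N, (((i : ℝ) * h, (j : ℝ) * h) : ℝ × ℝ) ∈
        Set.Icc ((0 : ℝ), (0 : ℝ)) (1, 1) := by
      intro i hi j hj
      have hi' : (i : ℝ) * h ≤ 1 := by
        rw [← hNh]; gcongr
      have hj' : (j : ℝ) * h ≤ 1 := by
        rw [← hNh]; gcongr
      exact ⟨⟨by positivity, by positivity⟩, ⟨hi', hj'⟩⟩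
    have hsum : ∑ i ∈ Finset.range N, ∑ j ∈ Finset.range N, (plaquette w i j).arg
        = 2 * Real.pi * k := by
      refine sum_arg_plaquette hN.ne' (by rwa [div_eq_mul_inv]) ?_ ?_ ?_ ?_
      · intro i hi j hj
        refine (norm_inner_sub_one_le (hv _ _)).trans
          (hδv _ (mem (i + 1) hi j hj) _ (mem i hi.le j hj) ?_).le
        rw [Prod.dist_eq, dist_self, Real.dist_eq]
        push_cast
        rw [show ((i : ℝ) + 1) * h - i * h = h by ring, abs_of_pos hpos, max_eq_left hpos.le]
        exact h1
      · intro i hi j hj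
        refine (norm_inner_sub_one_le (hv _ _)).trans
          (hδv _ (mem i hi (j + 1) hj) _ (mem i hi j hj.le) ?_).le
        rw [Prod.dist_eq, dist_self, Real.dist_eq]
        push_cast
        rw [show ((j : ℝ) + 1) * h - j * h = h by ring, abs_of_pos hpos, max_eq_right hpos.le]
        exact h1
      · intro j
        simp only [hw, hNh, Nat.cast_zero, zero_mul, px]
      · intro i
        simp only [hw, hNh, Nat.cast_zero, zero_mul, py]
        rw [mul_div_assoc, div_eq_mul_inv (i : ℝ)]
    have hplaq : ∀ i j : ℕ, |(plaquette w i j).arg| ≤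
        (2 * (L * h) ^ 2 + 4 * (L * h) ^ 3) / (1 - 4 * (L * h)) := by
      intro i j
      have e : plaquette w i j = ⟪w i j, P ((i + 1 : ℕ) * h) (j * h)
          (P ((i + 1 : ℕ) * h) ((j + 1 : ℕ) * h) (P (i * h) ((j + 1 : ℕ) * h) (w i j)))⟫_ℂ := by
        simp only [hPv, inner_smul_right, plaquette, inner_conj_symm, hw]
        ring
      have hside : ∀ {r s r' s' : ℝ}, (r - r') ^ 2 + (s - s') ^ 2 = h ^ 2 →
          ‖P r s - P r' s'‖ ≤ L * h := fun {r s r' s'} hd => by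
        have := hlip r s r' s'
        rwa [hd, Real.sqrt_sq hpos.le] at this
      have hdiag : ∀ {r s r' s' : ℝ}, (r - r') ^ 2 + (s - s') ^ 2 = 2 * h ^ 2 →
          ‖P r s - P r' s'‖ ≤ √2 * (L * h) := fun {r s r' s'} hd => by
        have := hlip r s r' s'
        rw [hd, Real.sqrt_mul (by norm_num), Real.sqrt_sq hpos.le] at this
        linarith
      have him := abs_im_inner_four_projections_le (p₀ := P (i * h) (j * h))
        (hP ((i + 1 : ℕ) * h) (j * h)) (hP ((i + 1 : ℕ) * h) ((j + 1 : ℕ) * h))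
        (hP (i * h) ((j + 1 : ℕ) * h)) (l := L * h) (hside (by push_cast; ring))
        (hdiag (by push_cast; ring)) (hdiag (by push_cast; ring)) (hv _ _) (hPself _ _)
      have hre := one_sub_le_re_inner_four_projections (p₀ := P (i * h) (j * h))
        (p₃ := P (i * h) ((j + 1 : ℕ) * h))
        (hP ((i + 1 : ℕ) * h) (j * h)) (hP ((i + 1 : ℕ) * h) ((j + 1 : ℕ) * h)) (l := L * h)
        (hside (by push_cast; ring)) (hdiag (by push_cast; ring)) (hside (by push_cast; ring))
        (hv _ _) (hPself _ _)
      rw [← show w i j = v (i * h) (j * h) from rfl, ← e] at him hre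
      have h3' : 0 < 1 - 4 * (L * h) := by linarith
      refine (Complex.abs_arg_le_abs_im_div_re (h3'.trans_le hre)).trans ?_
      gcongr
    calc 2 * Real.pi * |(k : ℝ)| = |2 * Real.pi * k| := by
          rw [abs_mul, abs_of_pos (by positivity : (0 : ℝ) < 2 * Real.pi)]
      _ ≤ ∑ i ∈ Finset.range N, ∑ j ∈ Finset.range N,
          (2 * (L * h) ^ 2 + 4 * (L * h) ^ 3) / (1 - 4 * (L * h)) := by
          rw [← hsum]
          refine (Finset.abs_sum_le_sum_abs _ _).trans (Finset.sum_le_sum fun i _ => ?_)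
          exact (Finset.abs_sum_le_sum_abs _ _).trans (Finset.sum_le_sum fun j _ => hplaq i j)
      _ = (2 * L ^ 2 * (N * h) ^ 2 + 4 * L ^ 3 * (N * h) ^ 2 * h) / (1 - 4 * (L * h)) := by
          simp only [Finset.sum_const, Finset.card_range, nsmul_eq_mul]
          ring
      _ = _ := by rw [hNh]; ring
  have hlim : Tendsto (fun N : ℕ => (2 * L ^ 2 + 4 * L ^ 3 * (N : ℝ)⁻¹) /
      (1 - 4 * (L * (N : ℝ)⁻¹))) atTop (𝓝 ((2 * L ^ 2 + 4 * L ^ 3 * 0) / (1 - 4 * (L * 0)))) :=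
    ((hinv.const_mul _).const_add _).div (((hinv.const_mul L).const_mul 4).const_sub 1) (by simp)
  have := ge_of_tendsto hlim hmain
  simp at this
  linarith

end ChernBound

/-! ### Explicit sections of the bundle and descent to the torus. -/

section Sections

theorem eventually_floor_eq_of_sin_ne_zero {s : ℝ} (hs : Real.sin (Real.pi * s) ≠ 0) :
    ∀ᶠ t in 𝓝 s, ⌊t⌋ = ⌊s⌋ := by
  have h1 : (⌊s⌋ : ℝ) < s := by
    refine lt_of_le_of_ne (Int.floor_le s) fun h => hs ?_
    rw [← h, mul_comm]
    exact Real.sin_int_mul_pi _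
  filter_upwards [Ioo_mem_nhds h1 (Int.lt_floor_add_one s)] with t ht
  exact Int.floor_eq_iff.2 ⟨ht.1.le, ht.2⟩

theorem norm_fourier_apply (m : ℤ) (r : UnitAddCircle) : ‖fourier m r‖ = 1 := by
  rw [fourier_apply]
  exact Circle.norm_coe _

/-- A section of the `k`-th line bundle which vanishes only on the circle `s ∈ ℤ`. -/
noncomputable def floorSection (k : ℤ) : C(UnitAddCircle × ℝ, ℂ) where
  toFun z := fourier (k * ⌊z.2⌋) z.1 * (|Real.sin (Real.pi * z.2)| : ℝ)
  continuous_toFun := by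
    have hsin : Continuous fun z : UnitAddCircle × ℝ => |Real.sin (Real.pi * z.2)| := by fun_prop
    rw [continuous_iff_continuousAt]
    intro z
    -- The floor jumps only at integers, where the sine factor vanishes and the other factor has
    -- modulus one.
    by_cases hz : Real.sin (Real.pi * z.2) = 0
    · have h0 : Tendsto (fun z : UnitAddCircle × ℝ => |Real.sin (Real.pi * z.2)|) (𝓝 z) (𝓝 0) := by
        simpa [hz] using hsin.tendsto z
      rw [ContinuousAt, hz]
      simp only [abs_zero, Complex.ofReal_zero, mul_zero]
      exact squeeze_zero_norm (fun w => by simp [norm_fourier_apply, -fourier_apply]) h0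
    · have hfl := (continuous_snd.tendsto z).eventually (eventually_floor_eq_of_sin_ne_zero hz)
      have hc : Continuous fun w : UnitAddCircle × ℝ =>
          fourier (k * ⌊z.2⌋) w.1 * ((|Real.sin (Real.pi * w.2)| : ℝ) : ℂ) :=
        ((map_continuous (fourier (k * ⌊z.2⌋))).comp continuous_fst).mul
          (Complex.continuous_ofReal.comp hsin)
      refine hc.continuousAt.congr ?_
      filter_upwards [hfl] with w hw
      rw [hw]

theorem floorSection_apply (k : ℤ) (r : UnitAddCircle) (s : ℝ) :
    floorSection k (r, s) = fourier (k * ⌊s⌋) r * (|Real.sin (Real.pi * s)| : ℝ) := rfl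

theorem floorSection_add_one (k : ℤ) (r : UnitAddCircle) (s : ℝ) :
    floorSection k (r, s + 1) = fourier k r * floorSection k (r, s) := by
  simp only [floorSection_apply]
  rw [Int.floor_add_one, mul_add, mul_one, fourier_add, mul_add Real.pi, mul_one, Real.sin_add_pi,
    abs_neg]
  ring

theorem conj_floorSection_mul_self (k : ℤ) (r : UnitAddCircle) (s : ℝ) :
    conj (floorSection k (r, s)) * floorSection k (r, s) = (Real.sin (Real.pi * s) ^ 2 : ℝ) := by
  rw [mul_comm, Complex.mul_conj, Complex.normSq_eq_norm_sq, floorSection_apply]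
  simp [norm_fourier_apply, -fourier_apply]

/-- Two sections of the `k`-th line bundle that form a normalized tight frame. -/
noncomputable def frameSection (k : ℤ) (i : Fin 2) : lineBundle k :=
  ⟨⟨fun z => floorSection k (z.1, z.2 + i / 2), by fun_prop⟩, fun r s => by
    change floorSection k (r, s + 1 + i / 2) = _ * floorSection k (r, s + i / 2)
    rw [← floorSection_add_one]
    ring_nf⟩

theorem frameSection_apply (k : ℤ) (i : Fin 2) (r : UnitAddCircle) (s : ℝ) :
    (frameSection k i).1 (r, s) = floorSection k (r, s + i / 2) := rfl

/-- Shifting by 1/2 turns the sine into a cosine, so this is sin² + cos² = 1. -/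
theorem sum_conj_frameSection_mul_self (k : ℤ) (z : UnitAddCircle × ℝ) :
    ∑ i, conj ((frameSection k i).1 z) * (frameSection k i).1 z = 1 := by
  obtain ⟨r, s⟩ := z
  simp only [Fin.sum_univ_two, frameSection_apply, conj_floorSection_mul_self]
  have h : Real.pi * (s + ((1 : Fin 2) : ℕ) / 2) = Real.pi * s + Real.pi / 2 := by
    simp; ring
  rw [h, Real.sin_add_pi_div_two]
  simp only [Fin.val_zero, Nat.cast_zero, zero_div, add_zero]
  rw [← Complex.ofReal_add, Real.sin_sq_add_cos_sq, Complex.ofReal_one]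

theorem isQuotientMap_torusCover : IsQuotientMap torusCover := by
  have h1 : IsOpenMap (fun z : UnitAddCircle × ℝ => (z.1, (z.2 : UnitAddCircle))) :=
    IsOpenMap.id.prodMap QuotientAddGroup.isOpenMap_coe
  have h2 : IsOpenMap torusCover :=
    (WithLp.homeomorphProd 2 UnitAddCircle UnitAddCircle).symm.isOpenMap.comp h1
  refine h2.isQuotientMap torusCover.continuous ?_
  intro x
  obtain ⟨s, hs⟩ := QuotientAddGroup.mk_surjective x.snd
  exact ⟨(x.fst, s), by
    change WithLp.toLp 2 (x.fst, (s : UnitAddCircle)) = x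
    rw [hs]; rfl⟩

theorem exists_descend_torusCover {f : C(UnitAddCircle × ℝ, ℂ)}
    (hf : ∀ r s, f (r, s + 1) = f (r, s)) :
    ∃ a : C(FlatTorus, ℂ), ∀ z, a (torusCover z) = f z := by
  have hfac : Function.FactorsThrough f torusCover := by
    rintro ⟨r, s⟩ ⟨r', s'⟩ h
    have h' := congrArg WithLp.ofLp h
    change (r, (s : UnitAddCircle)) = (r', (s' : UnitAddCircle)) at h'
    obtain ⟨rfl, h2⟩ := Prod.mk.inj h'
    have hper : Function.Periodic (fun s => f (r, s)) 1 := hf r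
    have := congrArg hper.lift h2
    simpa using this
  refine ⟨isQuotientMap_torusCover.lift f hfac, fun z => ?_⟩
  exact DFunLike.congr_fun (isQuotientMap_torusCover.lift_comp f hfac) z

theorem exists_coeff {k : ℤ} (ξ η : lineBundle k) :
    ∃ a : C(FlatTorus, ℂ), ∀ z, a (torusCover z) = conj (ξ.1 z) * η.1 z := by
  refine exists_descend_torusCover (f := ⟨fun z => conj (ξ.1 z) * η.1 z, by fun_prop⟩) ?_
  intro r s
  change conj (ξ.1 (r, s + 1)) * η.1 (r, s + 1) = conj (ξ.1 (r, s)) * η.1 (r, s)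
  rw [ξ.2 r s, η.2 r s, map_mul]
  have : conj (fourier k r) * fourier k r = 1 := by
    rw [mul_comm, Complex.mul_conj, Complex.normSq_eq_norm_sq]; simp [norm_fourier_apply, -fourier_apply]
  linear_combination conj (ξ.1 (r, s)) * η.1 (r, s) * this

end Sections

/-! ### Module maps as pointwise multiplication; rank one factorization. -/

section Frame

variable {k : ℤ}

/-- The value at `z` of the linear map `lineBundle k → C(𝕋²)` in the trivialization of the bundle
over `𝕋 × ℝ`. -/
noncomputable def bundleSymbol (φ : lineBundle k →ₗ[C(FlatTorus, ℂ)] C(FlatTorus, ℂ))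
    (z : UnitAddCircle × ℝ) : ℂ :=
  ∑ i, conj ((frameSection k i).1 z) * φ (frameSection k i) (torusCover z)

/-- By the tight frame identity, ξ is the combination of the frame sections with coefficients
conj(frame) · ξ. The twists cancel in these, so they lie in C(𝕋²) and linearity of φ applies. -/
theorem apply_eq_mul_bundleSymbol (φ : lineBundle k →ₗ[C(FlatTorus, ℂ)] C(FlatTorus, ℂ))
    (ξ : lineBundle k) (z : UnitAddCircle × ℝ) :
    φ ξ (torusCover z) = ξ.1 z * bundleSymbol φ z := by
  choose a ha using fun i => exists_coeff (frameSection k i) ξ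
  have hξ : ξ = ∑ i, a i • frameSection k i := by
    ext z
    have hs : (∑ i, a i • frameSection k i : lineBundle k).1 z =
        ∑ i, a i (torusCover z) * (frameSection k i).1 z := by
      simp only [Fin.sum_univ_two]
      rfl
    change ξ.1 z = _
    rw [hs]
    calc ξ.1 z = ξ.1 z * ∑ i, conj ((frameSection k i).1 z) * (frameSection k i).1 z := by
          rw [sum_conj_frameSection_mul_self, mul_one]
      _ = _ := by
          rw [Finset.mul_sum]
          exact Finset.sum_congr rfl fun i _ => by rw [ha]; ring
  conv_lhs => rw [hξ]
  rw [map_sum, bundleSymbol, Finset.mul_sum, ContinuousMap.coe_sum, Finset.sum_apply]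
  refine Finset.sum_congr rfl fun i _ => ?_
  rw [map_smul, smul_eq_mul, ContinuousMap.mul_apply, ha]
  ring

theorem continuous_bundleSymbol (φ : lineBundle k →ₗ[C(FlatTorus, ℂ)] C(FlatTorus, ℂ)) :
    Continuous (bundleSymbol φ) := by
  unfold bundleSymbol
  fun_prop

theorem torusCover_add_one (r : UnitAddCircle) (s : ℝ) :
    torusCover (r, s + 1) = torusCover (r, s) := by
  change WithLp.toLp 2 (r, ((s + 1 : ℝ) : UnitAddCircle)) = WithLp.toLp 2 (r, (s : UnitAddCircle))
  rw [AddCircle.coe_add_period 1 s]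

theorem bundleSymbol_add_one (φ : lineBundle k →ₗ[C(FlatTorus, ℂ)] C(FlatTorus, ℂ))
    (r : UnitAddCircle) (s : ℝ) :
    bundleSymbol φ (r, s + 1) = fourier (-k) r * bundleSymbol φ (r, s) := by
  simp only [bundleSymbol, torusCover_add_one, Finset.mul_sum]
  refine Finset.sum_congr rfl fun i _ => ?_
  rw [(frameSection k i).2 r s, map_mul, fourier_neg]
  ring

theorem exists_frameSection_ne_zero (k : ℤ) (z : UnitAddCircle × ℝ) :
    ∃ i, (frameSection k i).1 z ≠ 0 := by
  by_contra! h
  have := sum_conj_frameSection_mul_self k z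
  simp [h] at this

/-- A matrix representing the `k`-th line bundle has, over `𝕋 × ℝ`, rank one in a factorized form
`p_{ij} = u_i η_j` with `u` continuous, nowhere zero and twisted-periodic. -/
theorem exists_factorization {n : ℕ} {p : Matrix (Fin n) (Fin n) C(FlatTorus, ℂ)}
    (hp : IsIdempotentElem p)
    (e : lineBundle k ≃ₗ[C(FlatTorus, ℂ)] LinearMap.range (Matrix.mulVecLin p)) :
    ∃ (u η : UnitAddCircle × ℝ → Fin n → ℂ), Continuous u ∧
      (∀ r s, u (r, s + 1) = fourier (-k) r • u (r, s)) ∧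
      (∀ z i j, p i j (torusCover z) = u z i * η z j) ∧
      (∀ z, ∑ i, u z i * η z i = 1) := by
  set φ : Fin n → lineBundle k →ₗ[C(FlatTorus, ℂ)] C(FlatTorus, ℂ) := fun i =>
    LinearMap.proj i ∘ₗ (LinearMap.range (Matrix.mulVecLin p)).subtype ∘ₗ e.toLinearMap with hφ
  -- The sections corresponding to the columns of `p`.
  set η : Fin n → lineBundle k := fun j =>
    e.symm ⟨Matrix.mulVecLin p (Pi.single j 1), LinearMap.mem_range_self _ _⟩ with hη
  have hφη : ∀ i j, φ i (η j) = p i j := by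
    intro i j
    simp [hφ, hη]
  have hfac : ∀ z i j, p i j (torusCover z) = bundleSymbol (φ i) z * (η j).1 z := by
    intro z i j
    rw [← hφη, apply_eq_mul_bundleSymbol, mul_comm]
  refine ⟨fun z i => bundleSymbol (φ i) z, fun z j => (η j).1 z,
    continuous_pi fun i => continuous_bundleSymbol (φ i), fun r s => ?_, hfac, fun z => ?_⟩
  · ext i
    exact bundleSymbol_add_one (φ i) r s
  · obtain ⟨m, hm⟩ := exists_frameSection_ne_zero k z
    set ξ := frameSection k m
    have hpξ : Matrix.mulVecLin p (e ξ : Fin n → C(FlatTorus, ℂ)) = e ξ := by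
      obtain ⟨w, hw⟩ := (e ξ).2
      rw [← hw, ← LinearMap.comp_apply, ← Matrix.mulVecLin_mul, hp]
    -- Transport of the column expansion of `e ξ`, which `p` fixes. Evaluating at a point where ξ is
    -- nonzero and cancelling gives the trace identity.
    have hξ : ξ = ∑ j, φ j ξ • η j := by
      apply e.injective
      apply Subtype.ext
      rw [← hpξ]
      simp only [hη, map_sum, map_smul, LinearEquiv.apply_symm_apply, Submodule.coe_sum,
        Submodule.coe_smul]
      conv_lhs => rw [pi_eq_sum_univ' (e ξ : Fin n → C(FlatTorus, ℂ))]
      rw [map_sum]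
      exact Finset.sum_congr rfl fun j _ => map_smul _ _ _
    have hξz : ξ.1 z = ξ.1 z * ∑ j, bundleSymbol (φ j) z * (η j).1 z := by
      conv_lhs => rw [hξ]
      rw [Finset.mul_sum, Submodule.coe_sum, ContinuousMap.coe_sum, Finset.sum_apply]
      refine Finset.sum_congr rfl fun j _ => ?_
      change φ j ξ (torusCover z) * (η j).1 z = _
      rw [apply_eq_mul_bundleSymbol, mul_assoc]
    exact (mul_eq_left₀ hm).1 hξz.symm

end Frame

/-! ### Pointwise evaluation of the projection and its Lipschitz bound. -/

section Lipschitz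

theorem norm_sub_le_lipSeminorm_toReal_mul_dist {X : Type*} [MetricSpace X] {n : ℕ}
    {a : Matrix (Fin n) (Fin n) C(X, ℂ)} (ha : lipSeminorm a ≠ ∞) (x y : X) :
    ‖Matrix.toEuclideanCLM (n := Fin n) (𝕜 := ℂ) (a.map fun f => f x)
      - Matrix.toEuclideanCLM (n := Fin n) (𝕜 := ℂ) (a.map fun f => f y)‖
      ≤ (lipSeminorm a).toReal * dist x y := by
  rw [← map_sub]
  rcases eq_or_ne x y with rfl | hxy
  · simp
  · have h : ENNReal.ofReal (‖Matrix.toEuclideanCLM (n := Fin n) (𝕜 := ℂ)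
        (a.map (fun f => f x) - a.map (fun f => f y))‖ / dist x y) ≤ lipSeminorm a :=
      le_iSup_of_le x (le_iSup_of_le y (le_iSup_of_le hxy le_rfl))
    rwa [ENNReal.ofReal_le_iff_le_toReal ha, div_le_iff₀ (dist_pos.2 hxy)] at h

theorem dist_torusCover_le (r s r' s' : ℝ) :
    dist (torusCover ((r : UnitAddCircle), s)) (torusCover ((r' : UnitAddCircle), s'))
      ≤ √((r - r') ^ 2 + (s - s') ^ 2) := by
  have h : ∀ x y : ℝ, dist (x : UnitAddCircle) (y : UnitAddCircle) ^ 2 ≤ (x - y) ^ 2 := by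
    intro x y
    rw [← sq_abs (x - y)]
    gcongr
    rw [dist_eq_norm, ← AddCircle.coe_sub]
    exact QuotientAddGroup.norm_mk_le_norm
  rw [WithLp.prod_dist_eq_of_L2]
  exact Real.sqrt_le_sqrt (add_le_add (h r r') (h s s'))

theorem IsStarProjection.matrix_eval {X : Type*} [TopologicalSpace X] {n : ℕ}
    {p : Matrix (Fin n) (Fin n) C(X, ℂ)} (hp : IsStarProjection p) (x : X) :
    IsStarProjection (Matrix.toEuclideanCLM (n := Fin n) (𝕜 := ℂ) (p.map fun f => f x)) := by
  have h : IsStarProjection (p.map fun f => f x) := by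
    refine ⟨?_, ?_⟩
    · have := congrArg (fun q : Matrix (Fin n) (Fin n) C(X, ℂ) =>
        q.map (ContinuousMap.evalAlgHom ℂ ℂ x)) hp.isIdempotentElem
      simp only [Matrix.map_mul] at this
      exact this
    · ext i j
      have := congrArg (fun q : Matrix (Fin n) (Fin n) C(X, ℂ) => q i j x) hp.isSelfAdjoint
      exact this
  exact h.map _

/-- A projection of the factorized form `c ⊗ w` is the orthogonal projection onto the line of the
normalization of `w`. -/
theorem IsStarProjection.apply_eq_inner_smul {E : Type*} [NormedAddCommGroup E]
    [InnerProductSpace ℂ E] [CompleteSpace E] {P : E →L[ℂ] E} (hP : IsStarProjection P) {w : E}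
    {c : E → ℂ} (hw : ‖w‖ ≠ 0) (hc : ∀ y, P y = c y • w) (hPw : P w = w) (y : E) :
    P y = ⟪(‖w‖⁻¹ : ℂ) • w, y⟫_ℂ • (‖w‖⁻¹ : ℂ) • w := by
  have hw' : (‖w‖ : ℂ) ≠ 0 := by exact_mod_cast hw
  have h : ⟪w, y⟫_ℂ = c y * (‖w‖ : ℂ) ^ 2 := by
    have hww : ⟪w, w⟫_ℂ = (‖w‖ : ℂ) ^ 2 := inner_self_eq_norm_sq_to_K w
    rw [← hww, ← inner_smul_right, ← hc, ← hP.inner_left_eq, hPw]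
  rw [hc, inner_smul_left, h, smul_smul]
  congr 1
  simp only [map_inv₀, Complex.conj_ofReal]
  field_simp

end Lipschitz

/-! ### The lower bound for the Lipschitz seminorm. -/

theorem proposition12p1 (k : ℤ) (n : ℕ) (p : Matrix (Fin n) (Fin n) C(FlatTorus, ℂ))
    (hp : RepresentedBy (lineBundle k) p) :
    ENNReal.ofReal (Real.sqrt (Real.pi * |(k : ℝ)|)) ≤ lipSeminorm p := by
  obtain ⟨hproj, ⟨e⟩⟩ := hp
  by_cases htop : lipSeminorm p = ∞
  · rw [htop]; exact le_top
  rw [ENNReal.ofReal_le_iff_le_toReal htop]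
  refine Real.sqrt_le_iff.2 ⟨ENNReal.toReal_nonneg, ?_⟩
  obtain ⟨u, η, hu, hper, hfac, hone⟩ := exists_factorization hproj.isIdempotentElem e
  set U : ℝ → ℝ → EuclideanSpace ℂ (Fin n) := fun r s => WithLp.toLp 2 (u (r, s)) with hU
  have hUc : Continuous fun z : ℝ × ℝ => U z.1 z.2 :=
    (PiLp.continuous_toLp 2 _).comp (hu.comp
      (((AddCircle.continuous_mk' 1).comp continuous_fst).prodMk continuous_snd))
  -- A zero of `u` would contradict the trace identity ∑ uᵢηᵢ = 1.
  have hU0 : ∀ r s, ‖U r s‖ ≠ 0 := by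
    intro r s h
    have h0 : u (r, s) = 0 := by simpa [hU] using h
    simpa [h0] using hone (r, s)
  set P : ℝ → ℝ → EuclideanSpace ℂ (Fin n) →L[ℂ] EuclideanSpace ℂ (Fin n) := fun r s =>
    Matrix.toEuclideanCLM (n := Fin n) (𝕜 := ℂ)
      (p.map fun f => f (torusCover ((r : UnitAddCircle), s))) with hPdef
  have hP : ∀ r s, IsStarProjection (P r s) := fun r s => hproj.matrix_eval _
  have hPc : ∀ r s y, P r s y = (∑ j, η (r, s) j * y j) • U r s := by
    intro r s y
    ext i
    change ∑ j, p i j (torusCover ((r : UnitAddCircle), s)) * y j =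
      (∑ j, η (r, s) j * y j) * u (r, s) i
    rw [Finset.sum_mul]
    exact Finset.sum_congr rfl fun j _ => by rw [hfac]; ring
  have hPU : ∀ r s, P r s (U r s) = U r s := by
    intro r s
    rw [hPc]
    convert one_smul ℂ (U r s)
    rw [← hone (r, s)]
    exact Finset.sum_congr rfl fun j _ => mul_comm _ _
  have htwist : ∀ r : ℝ,
      U r 1 = Complex.exp ((-(2 * Real.pi * k * r) : ℝ) * Complex.I) • U r 0 := by
    intro r
    have h := hper (r : UnitAddCircle) 0
    rw [zero_add, fourier_coe_apply] at h
    simp only [hU, h, WithLp.toLp_smul]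
    congr 2
    push_cast
    ring
  refine pi_mul_abs_le_sq_of_lipschitz (k := k) (P := P)
    (v := fun r s => (‖U r s‖⁻¹ : ℂ) • U r s) ?_ ?_ ?_ ?_ hP ?_ ENNReal.toReal_nonneg ?_
  · exact (Continuous.inv₀ (Complex.continuous_ofReal.comp hUc.norm)
      fun z => Complex.ofReal_ne_zero.2 (hU0 z.1 z.2)).smul hUc
  · intro r s
    rw [norm_smul, norm_inv, Complex.norm_real, norm_norm, inv_mul_cancel₀ (hU0 r s)]
  · intro s
    have : ((1 : ℝ) : UnitAddCircle) = ((0 : ℝ) : UnitAddCircle) := by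
      rw [AddCircle.coe_period, AddCircle.coe_zero]
    simp only [hU, this]
  · intro r
    rw [htwist, norm_smul, Complex.norm_exp_ofReal_mul_I, one_mul, smul_comm]
  · exact fun r s y => (hP r s).apply_eq_inner_smul (hU0 r s) (hPc r s) (hPU r s) y
  · intro r s r' s'
    exact (norm_sub_le_lipSeminorm_toReal_mul_dist htop _ _).trans
      (mul_le_mul_of_nonneg_left (dist_torusCover_le r s r' s') ENNReal.toReal_nonneg)
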